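/- Let $p,q$ be positive integers and let $(\bar M,\bar g,\bar J)$ be a metallic semi-Riemannian manifold: $\bar g$ is a semi-Riemannian metric of constant index and $\bar J$ is a smooth $(1,1)$-tensor field with $\bar J^2=p\bar J+qI$ and $\bar g(U,\bar JV)=\bar g(\bar JU,V)$. Let $\bar\nabla$ be the Levi-Civita connection of $\bar g$, let $\eta$ be a smooth vector field on $\bar M$, $\pi(V)=\bar g(V,\eta)$, and let $$\bar D_UV=\bar\nabla_UV+\pi(V)\bar JU$$ be the associated quarter symmetric non-metric connection. Let $(M,g,S(TM),S(TM^\perp))$ be an $r$-lightlike submanifold of $\bar M$, that is, an immersed submanifold for which $Rad(TM)=TM\cap TM^\perp$ is a smooth distribution of rank $r>0$, with a screen distribution $S(TM)$ (a smooth complement of $Rad(TM)$ in $TM$), a screen transversal bundle $S(TM^\perp)$ (a smooth complement of $Rad(TM)$ in $TM^\perp$) and a lightlike transversal bundle $ltr(TM)$, so that $T\bar M|_M=(Rad(TM)\oplus ltr(TM))\perp S(TM)\perp S(TM^\perp)$ with $ltr(TM)$ totally null. Assume that $M$ is screen semi-invariant: $\bar J(Rad(TM))=Rad(TM)$, and there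 is a distribution $B\subseteq S(TM)$ with orthogonal complement $B^\perp$ in $S(TM)$ such that $S(TM)=B\oplus B^\perp$, $\bar J(B)=B$ and $\bar J(B^\perp)\subseteq S(TM^\perp)$. Assume moreover that $(\bar\nabla_U\bar J)V=0$ for all $U,V\in\Gamma(TM)$ (for instance that $\bar\nabla\bar J=0$); equivalently, $\bar D_U\bar JV=\bar J\bar D_UV-p\pi(V)\bar JU-q\pi(V)U+\pi(\bar JV)\bar JU$ for all $U,V\in\Gamma(TM)$. For $U,V\in\Gamma(TM)$ decompose $\bar D_UV=D_UV+\bar h^l(U,V)+\bar h^s(U,V)$ according to $T\bar M|_M=TM\oplus ltr(TM)\oplus S(TM^\perp)$, and for $U\in\Gamma(TM)$, $E\in\Gamma(Rad(TM))$ decompose $D_UE=-\bar A^*_EU+\bar\nabla^{*t}_UE$ according to $TM=S(TM)\oplus Rad(TM)$. **Theorem.** The distribution $Rad(TM)$ is integrable (that is, $[E,E']\in\Gamma(Rad(TM))$ for all $E,E'\in\Gamma(Rad(TM))$) if and only if both of the following conditions hold for all $E,E'\in\Gamma(Rad(TM))$: (i) $\bar A^*_{\bar JE}E'+p\,\bar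 A^*_{E'}E=\bar A^*_{\bar JE'}E+p\,\bar A^*_EE'$; (ii) $\bar h^s(E,\bar JE')=\bar h^s(E',\bar JE)$. -/

import Mathlib

open Bundle Set Filter
open scoped Manifold ContDiff Topology

noncomputable section

namespace LightlikeGeometry

/-! ### Semi-Riemannian metrics and the Levi-Civita connection -/

/-- The index of a symmetric bilinear form: the largest dimension of a subspace on which the form
is negative definite. -/
def formIndex {V : Type*} [AddCommGroup V] [Module ℝ V] (b : V → V → ℝ) : ℕ :=
  sSup {k : ℕ | ∃ W : Submodule ℝ V, Module.finrank ℝ W = k ∧ ∀ w ∈ W, w ≠ 0 → b w w < 0}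

/-- A semi-Riemannian metric on `N`: a smooth symmetric nondegenerate `(0,2)`-tensor field of
constant index. -/
structure SemiRiemannianMetric (F : Type*) [NormedAddCommGroup F] [NormedSpace ℝ F]
    (N : Type*) [TopologicalSpace N] [ChartedSpace F N] [IsManifold 𝓘(ℝ, F) ∞ N] where
  inner (y : N) : TangentSpace 𝓘(ℝ, F) y →L[ℝ] TangentSpace 𝓘(ℝ, F) y →L[ℝ] ℝ
  symm (y : N) (v w : TangentSpace 𝓘(ℝ, F) y) : inner y v w = inner y w v
  nondegenerate (y : N) (v : TangentSpace 𝓘(ℝ, F) y) (hv : ∀ w, inner y v w = 0) : v = 0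
  index_const (y z : N) :
    formIndex (fun v w ↦ inner y v w) = formIndex (fun v w ↦ inner z v w)
  contMDiff : ContMDiff 𝓘(ℝ, F) (𝓘(ℝ, F).prod 𝓘(ℝ, F →L[ℝ] F →L[ℝ] ℝ)) ∞
    (fun y ↦ TotalSpace.mk' (F →L[ℝ] F →L[ℝ] ℝ)
      (E := fun y : N ↦ TangentSpace 𝓘(ℝ, F) y →L[ℝ] TangentSpace 𝓘(ℝ, F) y →L[ℝ] ℝ)
      y (inner y))

section Ambient

variable {F : Type*} [NormedAddCommGroup F] [NormedSpace ℝ F] [FiniteDimensional ℝ F]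
  {N : Type*} [TopologicalSpace N] [ChartedSpace F N] [IsManifold 𝓘(ℝ, F) ∞ N]

/-- The orthogonal space `W^⊥` of a subspace `W` of `T_y N`. -/
def SemiRiemannianMetric.orth (g : SemiRiemannianMetric F N) {y : N}
    (W : Submodule ℝ (TangentSpace 𝓘(ℝ, F) y)) : Submodule ℝ (TangentSpace 𝓘(ℝ, F) y) where
  carrier := {v | ∀ w ∈ W, g.inner y v w = 0}
  zero_mem' := by intro w _; simp
  add_mem' := by
    intro a b ha hb w hw
    simp [ha w hw, hb w hw]
  smul_mem' := by
    intro c a ha w hw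
    simp [ha w hw]

/-- `nab` is the Levi-Civita connection of `g`: the torsion-free connection on `TN` with
`u (g(X, Y)) = g(∇_u X, Y) + g(X, ∇_u Y)`.
Recall that `nab X y u` is Mathlib's notation for `(∇_u X)(y)`. -/
structure IsLeviCivita (g : SemiRiemannianMetric F N)
    (nab : CovariantDerivative 𝓘(ℝ, F) F (fun y : N ↦ TangentSpace 𝓘(ℝ, F) y)) : Prop where
  torsion_free : nab.torsion = 0
  metric (X Y : (y : N) → TangentSpace 𝓘(ℝ, F) y) (y : N)
    (hX : MDifferentiableAt 𝓘(ℝ, F) 𝓘(ℝ, F).tangent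
      (fun z ↦ (⟨z, X z⟩ : TangentBundle 𝓘(ℝ, F) N)) y)
    (hY : MDifferentiableAt 𝓘(ℝ, F) 𝓘(ℝ, F).tangent
      (fun z ↦ (⟨z, Y z⟩ : TangentBundle 𝓘(ℝ, F) N)) y)
    (u : TangentSpace 𝓘(ℝ, F) y) :
    (mfderiv 𝓘(ℝ, F) 𝓘(ℝ, ℝ) (fun z ↦ g.inner z (X z) (Y z)) y u : ℝ) =
      g.inner y (nab X y u) (Y y) + g.inner y (X y) (nab Y y u)

/-! ### Metallic structures and the quarter symmetric non-metric connection -/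

/-- A metallic structure on `(N, g)`: a smooth `(1,1)`-tensor field `J` with `J² = p J + q I` such
that `g` is `J`-compatible, i.e. `g(U, J V) = g(J U, V)`. -/
structure MetallicStructure (g : SemiRiemannianMetric F N) (p q : ℕ) where
  toFun (y : N) : TangentSpace 𝓘(ℝ, F) y →L[ℝ] TangentSpace 𝓘(ℝ, F) y
  contMDiff : ContMDiff 𝓘(ℝ, F) (𝓘(ℝ, F).prod 𝓘(ℝ, F →L[ℝ] F)) ∞
    (fun y ↦ TotalSpace.mk' (F →L[ℝ] F)
      (E := fun y : N ↦ TangentSpace 𝓘(ℝ, F) y →L[ℝ] TangentSpace 𝓘(ℝ, F) y)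
      y (toFun y))
  sq_eq (y : N) (v : TangentSpace 𝓘(ℝ, F) y) :
    toFun y (toFun y v) = (p : ℝ) • toFun y v + (q : ℝ) • v
  compatible (y : N) (v w : TangentSpace 𝓘(ℝ, F) y) :
    g.inner y v (toFun y w) = g.inner y (toFun y v) w

/-- The quarter symmetric non-metric connection `D̄_U V = ∇_U V + π(V) J U`,
where `π(V) = g(V, η) = g(η, V)`. -/
def quarterSymmetricConnection {g : SemiRiemannianMetric F N} {p q : ℕ}
    (J : MetallicStructure g p q) (η : (y : N) → TangentSpace 𝓘(ℝ, F) y)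
    (nab : CovariantDerivative 𝓘(ℝ, F) F (fun y : N ↦ TangentSpace 𝓘(ℝ, F) y)) :
    CovariantDerivative 𝓘(ℝ, F) F (fun y : N ↦ TangentSpace 𝓘(ℝ, F) y) :=
  nab.addOneForm (fun y ↦ (g.inner y (η y)).smulRight (J.toFun y))

end Ambient

section Submanifold

variable {F : Type*} [NormedAddCommGroup F] [NormedSpace ℝ F] [FiniteDimensional ℝ F]
  {N : Type*} [TopologicalSpace N] [ChartedSpace F N] [IsManifold 𝓘(ℝ, F) ∞ N]
  {E : Type*} [NormedAddCommGroup E] [NormedSpace ℝ E] [FiniteDimensional ℝ E]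
  {M : Type*} [TopologicalSpace M] [ChartedSpace E M] [IsManifold 𝓘(ℝ, E) ∞ M]

/-! ### Sections and subbundles of `TN|_M`, where `f : M → N` is the immersion of `M` -/

/-- A section `V` of `TN|_M` is smooth on `s`. -/
def SmoothAlongOn (f : M → N) (V : (x : M) → TangentSpace 𝓘(ℝ, F) (f x)) (s : Set M) : Prop :=
  ContMDiffOn 𝓘(ℝ, E) 𝓘(ℝ, F).tangent ∞ (fun x ↦ (⟨f x, V x⟩ : TangentBundle 𝓘(ℝ, F) N)) s

/-- `W` is a smooth vector subbundle of `TN|_M` of rank `k`: it has smooth frames near every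
point. -/
def IsSmoothSubbundle (f : M → N) (k : ℕ)
    (W : (x : M) → Submodule ℝ (TangentSpace 𝓘(ℝ, F) (f x))) : Prop :=
  ∀ x₀ : M, ∃ s ∈ 𝓝 x₀, ∃ e : Fin k → (x : M) → TangentSpace 𝓘(ℝ, F) (f x),
    (∀ i, SmoothAlongOn (E := E) f (e i) s) ∧
    ∀ x ∈ s, LinearIndependent ℝ (fun i ↦ e i x) ∧
      Submodule.span ℝ (range fun i ↦ e i x) = W x

/-- The connection induced on `TN|_M` by a connection `cov` on `TN`: the value `(∇_u V)(x)` for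
`u ∈ T_x M` and a section `V` of `TN|_M`. Let `w` be the coordinates of `V` in the coordinate frame
`(∂_i)` of `TN` around `f x`. The formula reads
`∇_u V = ∑ dw^i(u) ∂_i + cov_{df(u)} (∑ w^i(x) ∂_i)`, with constants `w^i(x)` in the last term. -/
def covAlong (f : M → N)
    (cov : CovariantDerivative 𝓘(ℝ, F) F (fun y : N ↦ TangentSpace 𝓘(ℝ, F) y))
    (V : (x : M) → TangentSpace 𝓘(ℝ, F) (f x)) (x : M) (u : TangentSpace 𝓘(ℝ, E) x) :
    TangentSpace 𝓘(ℝ, F) (f x) :=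
  let t := trivializationAt F (fun y : N ↦ TangentSpace 𝓘(ℝ, F) y) (f x)
  let w : M → F := fun z ↦ (t ⟨f z, V z⟩).2
  t.symm (f x) (mfderiv 𝓘(ℝ, E) 𝓘(ℝ, F) w x u) +
    cov (fun y ↦ t.symm y (w x)) (f x) (mfderiv 𝓘(ℝ, E) 𝓘(ℝ, F) f x u)

/-- The tangent space `T_x M` as a subspace of `T_{f x} N`. -/
def tangentImage (f : M → N) (x : M) : Submodule ℝ (TangentSpace 𝓘(ℝ, F) (f x)) :=
  LinearMap.range (mfderiv 𝓘(ℝ, E) 𝓘(ℝ, F) f x).toLinearMap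

/-- A vector field on `M` as a section of `TN|_M`. -/
def pushField (f : M → N) (X : (x : M) → TangentSpace 𝓘(ℝ, E) x) (x : M) :
    TangentSpace 𝓘(ℝ, F) (f x) :=
  mfderiv 𝓘(ℝ, E) 𝓘(ℝ, F) f x (X x)

/-- The radical distribution `Rad T_x M = T_x M ∩ (T_x M)^⊥`. -/
def radical (g : SemiRiemannianMetric F N) (f : M → N) (x : M) :
    Submodule ℝ (TangentSpace 𝓘(ℝ, F) (f x)) :=
  tangentImage (E := E) f x ⊓ g.orth (tangentImage (E := E) f x)

/-! ### Lightlike submanifolds -/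

variable (E M) in
/-- An `r`-lightlike submanifold `(M, S(TM), S(TM^⊥))` of `(N, g)`, with a lightlike transversal
bundle `ltr(TM)`. All bundles are regarded as subbundles of `TN|_M`, so that
`TN|_M = (Rad(TM) ⊕ ltr(TM)) ⊥ S(TM) ⊥ S(TM^⊥)`. -/
structure LightlikeSubmanifold (g : SemiRiemannianMetric F N) where
  /-- The immersion of `M` into `N`. -/
  f : M → N
  immersion : Manifold.IsImmersion 𝓘(ℝ, E) 𝓘(ℝ, F) ∞ f
  /-- The rank of the radical distribution. -/
  r : ℕ
  r_pos : 0 < r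
  radical_smooth : IsSmoothSubbundle (E := E) f r (radical (E := E) g f)
  /-- The screen distribution `S(TM)`, a complement of `Rad(TM)` in `TM`. -/
  screen (x : M) : Submodule ℝ (TangentSpace 𝓘(ℝ, F) (f x))
  screen_smooth : ∃ k, IsSmoothSubbundle (E := E) f k screen
  radical_disjoint_screen (x : M) : Disjoint (radical (E := E) g f x) (screen x)
  radical_sup_screen (x : M) :
    radical (E := E) g f x ⊔ screen x = tangentImage (E := E) f x
  /-- The screen transversal bundle `S(TM^⊥)`, a complement of `Rad(TM)` in `TM^⊥`. -/
  screenTr (x : M) : Submodule ℝ (TangentSpace 𝓘(ℝ, F) (f x))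
  screenTr_smooth : ∃ k, IsSmoothSubbundle (E := E) f k screenTr
  radical_disjoint_screenTr (x : M) : Disjoint (radical (E := E) g f x) (screenTr x)
  radical_sup_screenTr (x : M) :
    radical (E := E) g f x ⊔ screenTr x = g.orth (tangentImage (E := E) f x)
  /-- The lightlike transversal bundle `ltr(TM)`: totally null, orthogonal to `S(TM)` and to
  `S(TM^⊥)`, and such that `tr(TM) = ltr(TM) ⊥ S(TM^⊥)` is a complement of `TM` in `TN|_M`. -/
  ltr (x : M) : Submodule ℝ (TangentSpace 𝓘(ℝ, F) (f x))
  ltr_smooth : IsSmoothSubbundle (E := E) f r ltr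
  ltr_null (x : M) : ltr x ≤ g.orth (ltr x)
  ltr_orth_screen (x : M) : ltr x ≤ g.orth (screen x)
  ltr_orth_screenTr (x : M) : ltr x ≤ g.orth (screenTr x)
  ltr_disjoint_screenTr (x : M) : Disjoint (ltr x) (screenTr x)
  isCompl_tr (x : M) : IsCompl (tangentImage (E := E) f x) (ltr x ⊔ screenTr x)

namespace LightlikeSubmanifold

set_option linter.unusedSectionVars false

variable {g : SemiRiemannianMetric F N} (S : LightlikeSubmanifold E M g)

/-- `Rad(TM)`. -/
abbrev rad (x : M) : Submodule ℝ (TangentSpace 𝓘(ℝ, F) (S.f x)) := radical (E := E) g S.f x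

/-- `TM` as a subbundle of `TN|_M`. -/
abbrev tan (x : M) : Submodule ℝ (TangentSpace 𝓘(ℝ, F) (S.f x)) := tangentImage (E := E) S.f x

lemma isCompl_screen (x : M) : IsCompl (S.screen x) (S.rad x ⊔ (S.ltr x ⊔ S.screenTr x)) := by
  have h := S.isCompl_tr x
  rw [← S.radical_sup_screen x, sup_comm] at h
  exact (S.radical_disjoint_screen x).symm.isCompl_sup_right_of_isCompl_sup_left h

lemma isCompl_screenTr (x : M) : IsCompl (S.screenTr x) (S.ltr x ⊔ S.tan x) := by
  have h := (S.isCompl_tr x).symm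
  rw [sup_comm] at h
  exact (S.ltr_disjoint_screenTr x).symm.isCompl_sup_right_of_isCompl_sup_left h

/-- The projection of `TN|_M = TM ⊕ ltr(TM) ⊕ S(TM^⊥)` onto `TM`. -/
def projTan (x : M) : TangentSpace 𝓘(ℝ, F) (S.f x) →ₗ[ℝ] TangentSpace 𝓘(ℝ, F) (S.f x) :=
  (S.tan x).projection (S.ltr x ⊔ S.screenTr x) (S.isCompl_tr x)

/-- The projection of `TN|_M = TM ⊕ ltr(TM) ⊕ S(TM^⊥)` onto `S(TM^⊥)`. -/
def projScreenTr (x : M) : TangentSpace 𝓘(ℝ, F) (S.f x) →ₗ[ℝ] TangentSpace 𝓘(ℝ, F) (S.f x) :=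
  (S.screenTr x).projection (S.ltr x ⊔ S.tan x) (S.isCompl_screenTr x)

/-- The projection onto `S(TM)`. On `TM = S(TM) ⊕ Rad(TM)` it is the projection along `Rad(TM)`. -/
def projScreen (x : M) : TangentSpace 𝓘(ℝ, F) (S.f x) →ₗ[ℝ] TangentSpace 𝓘(ℝ, F) (S.f x) :=
  (S.screen x).projection (S.rad x ⊔ (S.ltr x ⊔ S.screenTr x)) (S.isCompl_screen x)

variable (cov : CovariantDerivative 𝓘(ℝ, F) F (fun y : N ↦ TangentSpace 𝓘(ℝ, F) y))

/-- The induced connection on `M`: the tangential part `D_u V` of `cov_u V` for `V` tangent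
to `M`. -/
def inducedConnection (V : (x : M) → TangentSpace 𝓘(ℝ, F) (S.f x)) (x : M)
    (u : TangentSpace 𝓘(ℝ, E) x) : TangentSpace 𝓘(ℝ, F) (S.f x) :=
  S.projTan x (covAlong S.f cov V x u)

/-- The `S(TM^⊥)`-valued second fundamental form: the part `h^s(u, V)` in `S(TM^⊥)` of
`cov_u V = D_u V + h^l(u, V) + h^s(u, V)`, for `V` tangent to `M`. -/
def screenSecondFundamentalForm (x : M) (u : TangentSpace 𝓘(ℝ, E) x)
    (V : (x : M) → TangentSpace 𝓘(ℝ, F) (S.f x)) : TangentSpace 𝓘(ℝ, F) (S.f x) :=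
  S.projScreenTr x (covAlong S.f cov V x u)

/-- The shape operator `A^*_ξ u` of the radical distribution, for a section `ξ` of `Rad(TM)`:
`-A^*_ξ u` is the part in `S(TM)` of `D_u ξ = -A^*_ξ u + ∇^{*t}_u ξ`. -/
def radicalShapeOperator (ξ : (x : M) → TangentSpace 𝓘(ℝ, F) (S.f x)) (x : M)
    (u : TangentSpace 𝓘(ℝ, E) x) : TangentSpace 𝓘(ℝ, F) (S.f x) :=
  -S.projScreen x (S.inducedConnection cov ξ x u)

/-- A smooth vector field on `M`. -/
def IsSmoothField (X : (x : M) → TangentSpace 𝓘(ℝ, E) x) : Prop :=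
  ContMDiff 𝓘(ℝ, E) 𝓘(ℝ, E).tangent ∞ (fun x ↦ (⟨x, X x⟩ : TangentBundle 𝓘(ℝ, E) M))

/-- `X ∈ Γ(Rad(TM))`. -/
def IsRadicalField (X : (x : M) → TangentSpace 𝓘(ℝ, E) x) : Prop :=
  IsSmoothField X ∧ ∀ x, pushField S.f X x ∈ S.rad x

/-- `Rad(TM)` is integrable: `[X, Y] ∈ Γ(Rad(TM))` for all `X, Y ∈ Γ(Rad(TM))`. -/
def RadicalIntegrable : Prop :=
  ∀ X Y : (x : M) → TangentSpace 𝓘(ℝ, E) x, S.IsRadicalField X → S.IsRadicalField Y →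
    S.IsRadicalField (VectorField.mlieBracket 𝓘(ℝ, E) X Y)

variable {p q : ℕ} (J : MetallicStructure g p q)

/-- The section `J V` of `TN|_M`, for a vector field `V` on `M`. -/
def applyJ (V : (x : M) → TangentSpace 𝓘(ℝ, E) x) (x : M) : TangentSpace 𝓘(ℝ, F) (S.f x) :=
  J.toFun (S.f x) (pushField S.f V x)

/-- `(∇_U J) V = 0`, i.e. `∇_U (J V) = J (∇_U V)`, for all `U, V ∈ Γ(TM)`. For the Levi-Civita
connection `∇` this is equivalent to
`D̄_U (J V) = J (D̄_U V) - p π(V) J U - q π(V) U + π(J V) J U`, and it holds if `∇ J = 0`. -/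
def IsParallelOnTangent : Prop :=
  ∀ V : (x : M) → TangentSpace 𝓘(ℝ, E) x, IsSmoothField V →
    ∀ (x : M) (u : TangentSpace 𝓘(ℝ, E) x),
      covAlong S.f cov (S.applyJ J V) x u =
        J.toFun (S.f x) (covAlong S.f cov (pushField S.f V) x u)

/-- Screen semi-invariant lightlike submanifolds: there is a distribution `B ⊆ S(TM)` with
orthogonal complement `B^⊥` in `S(TM)` such that `S(TM) = B ⊕ B^⊥`, `J B = B`,
`J B^⊥ ⊆ S(TM^⊥)`, and moreover `J Rad(TM) = Rad(TM)`. -/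
def IsScreenSemiInvariant : Prop :=
  (∃ B : (x : M) → Submodule ℝ (TangentSpace 𝓘(ℝ, F) (S.f x)),
    (∃ k, IsSmoothSubbundle (E := E) S.f k B) ∧
    ∀ x, B x ≤ S.screen x ∧
      Disjoint (B x) (g.orth (B x) ⊓ S.screen x) ∧
      B x ⊔ (g.orth (B x) ⊓ S.screen x) = S.screen x ∧
      (B x).map (J.toFun (S.f x)).toLinearMap = B x ∧
      (g.orth (B x) ⊓ S.screen x).map (J.toFun (S.f x)).toLinearMap ≤ S.screenTr x) ∧
  ∀ x, (S.rad x).map (J.toFun (S.f x)).toLinearMap = S.rad x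

end LightlikeSubmanifold

end Submanifold

end LightlikeGeometry

end

/-!
Let `X, Y` be radical fields and `W = [X, Y]`, as a section of `TN|_M`. The Levi-Civita connection
is torsion-free along the immersion (`covAlong_pushField_sub`), so `W = ∇_X Y - ∇_Y X`, and since
`J` is parallel along `M`, `J W = ∇_X (J Y) - ∇_Y (J X)`. Replacing `∇` by the quarter symmetric
connection changes `∇_X V` by a multiple of `J X`, which is radical and thus invisible to the
projections onto `S(TM)` and `S(TM^⊥)`. Hence the first condition on `X, Y` says that the
`S(TM)`-parts of `J W` and of `p W` agree, and the second one that the `S(TM^⊥)`-part of `J W`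
vanishes.

The rest is linear algebra at a point (`IsScreenSemiInvariant.mem_rad_iff`). Write `W = ξ + b + b'`
along `TM = Rad(TM) ⊕ B ⊕ B^⊥`. Then `J W = J ξ + J b + J b'` with `J ξ` radical, `J b` in `S(TM)`
and `J b'` in `S(TM^⊥)`, and the two conditions read `J b = p (b + b')` and `J b' = 0`. As
`J² = p J + q I` with `q ≠ 0`, they force `b' = 0` and then `b = 0`, so that `W` is radical.

Since `covAlong` is defined in coordinates, torsion-freeness along the immersion has to be derived
from the torsion-freeness of `∇` on the ambient manifold. The tool is the identity
`[X, Y] ψ = X (Y ψ) - Y (X ψ)` for vector-valued functions `ψ` (`mvfderiv_apply_mlieBracket`).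
-/

namespace LightlikeGeometry

/-! ### Lie brackets as commutators of derivations -/

section Bracket

variable {E : Type*} [NormedAddCommGroup E] [NormedSpace ℝ E]
  {M : Type*} [TopologicalSpace M] [ChartedSpace E M]
  {F : Type*} [NormedAddCommGroup F] [NormedSpace ℝ F]

lemma mvfderiv_congr_of_eventuallyEq {w w' : M → F} {x : M} (h : w =ᶠ[𝓝 x] w') :
    mvfderiv 𝓘(ℝ, E) w x = mvfderiv 𝓘(ℝ, E) w' x := by
  ext v
  exact congrArg (fun L : E →L[ℝ] F ↦ L v) (h.mfderiv_eq (I := 𝓘(ℝ, E)) (I' := 𝓘(ℝ, F)))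

variable [CompleteSpace E] [IsManifold 𝓘(ℝ, E) ∞ M]

open VectorField in
/-- As derivations of vector-valued functions, `[X, Y] ψ = X (Y ψ) - Y (X ψ)`. In the chart at `x`
this is the corresponding identity for vector fields on a vector space. -/
lemma mvfderiv_apply_mlieBracket {ψ : M → F} {x : M} (hψ : ContMDiffAt 𝓘(ℝ, E) 𝓘(ℝ, F) ∞ ψ x)
    {X Y : (x : M) → TangentSpace 𝓘(ℝ, E) x}
    (hX : MDifferentiableAt 𝓘(ℝ, E) 𝓘(ℝ, E).tangent
      (fun z ↦ (⟨z, X z⟩ : TangentBundle 𝓘(ℝ, E) M)) x)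
    (hY : MDifferentiableAt 𝓘(ℝ, E) 𝓘(ℝ, E).tangent
      (fun z ↦ (⟨z, Y z⟩ : TangentBundle 𝓘(ℝ, E) M)) x) :
    mvfderiv 𝓘(ℝ, E) ψ x (mlieBracket 𝓘(ℝ, E) X Y x) =
      mvfderiv 𝓘(ℝ, E) (fun z ↦ mvfderiv 𝓘(ℝ, E) ψ z (Y z)) x (X x) -
      mvfderiv 𝓘(ℝ, E) (fun z ↦ mvfderiv 𝓘(ℝ, E) ψ z (X z)) x (Y x) := by
  set e := extChartAt 𝓘(ℝ, E) x
  set h : E → F := ψ ∘ e.symm with hh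
  have hxs : x ∈ e.source := mem_extChartAt_source x
  have hhc : ContDiffAt ℝ ∞ h (e x) := by
    rw [← contMDiffAt_iff_contDiffAt, ← contMDiffWithinAt_univ]
    refine ContMDiffAt.comp_contMDiffWithinAt_of_eq (y := x) hψ ?_ (e.left_inv hxs)
    simpa only [modelWithCornersSelf_coe, range_id] using
      contMDiffWithinAt_extChartAt_symm_range_self (I := 𝓘(ℝ, E)) (n := ∞) x
  have hhev : ∀ᶠ y in 𝓝 (e x), DifferentiableAt ℝ h y := by
    have h2 : ContDiffAt ℝ 1 h (e x) := hhc.of_le (by simp)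
    filter_upwards [h2.eventually (by simp)] with y hy using hy.differentiableAt one_ne_zero
  have hec : ContinuousAt e x := continuousAt_extChartAt x
  -- `dψ = dh ∘ de` near `x`
  have hd : ∀ᶠ z in 𝓝 x, ∀ v : TangentSpace 𝓘(ℝ, E) z, mvfderiv 𝓘(ℝ, E) ψ z v =
      fderiv ℝ h (e z) (mfderiv 𝓘(ℝ, E) 𝓘(ℝ, E) e z v) := by
    filter_upwards [hec.eventually hhev, eventually_eventually_nhds.2
      (extChartAt_source_mem_nhds (I := 𝓘(ℝ, E)) x)] with z hz hzs v
    have heq : ψ =ᶠ[𝓝 z] h ∘ e := by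
      filter_upwards [hzs] with y hy
      simp only [hh, Function.comp_apply, e.left_inv hy]
    have hze : MDifferentiableAt 𝓘(ℝ, E) 𝓘(ℝ, E) e z :=
      mdifferentiableAt_extChartAt ((extChartAt_source 𝓘(ℝ, E) x).subset hzs.self_of_nhds)
    rw [mvfderiv_congr_of_eventuallyEq heq]
    have := mfderiv_comp z hz.mdifferentiableAt hze
    rw [mfderiv_eq_fderiv] at this
    exact congrArg (fun L : E →L[ℝ] F ↦ L v) this
  -- the representative of `Z` in the chart is `de (Z)`
  have key (Z : (x : M) → TangentSpace 𝓘(ℝ, E) x) : ∀ᶠ z in 𝓝 x,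
      mfderiv 𝓘(ℝ, E) 𝓘(ℝ, E) e z (Z z) =
        mpullbackWithin 𝓘(ℝ, E) 𝓘(ℝ, E) e.symm Z (range 𝓘(ℝ, E)) (e z) := by
    have h1 := eventuallyEq_mpullback_mpullbackWithin_extChartAt (I := 𝓘(ℝ, E)) (s := univ)
      (x := x) Z
    rw [nhdsWithin_univ] at h1
    filter_upwards [h1, extChartAt_source_mem_nhds (I := 𝓘(ℝ, E)) x] with z hz hzs
    conv_lhs => rw [hz]
    rw [mpullback_apply]
    exact (isInvertible_mfderiv_extChartAt hzs).self_apply_inverse _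
  have hdiff {Z : (x : M) → TangentSpace 𝓘(ℝ, E) x} (hZ : MDifferentiableAt 𝓘(ℝ, E)
      𝓘(ℝ, E).tangent (fun z ↦ (⟨z, Z z⟩ : TangentBundle 𝓘(ℝ, E) M)) x) :
      DifferentiableAt ℝ (mpullbackWithin 𝓘(ℝ, E) 𝓘(ℝ, E) e.symm Z (range 𝓘(ℝ, E))) (e x) := by
    have := (mdifferentiableWithinAt_univ.2 hZ).differentiableWithinAt_mpullbackWithin_vectorField
    refine differentiableWithinAt_univ.1 ?_
    rw [modelWithCornersSelf_coe, range_id] at this ⊢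
    rwa [preimage_univ, univ_inter] at this
  have hDh : DifferentiableAt ℝ (fderiv ℝ h) (e x) :=
    (hhc.fderiv_right (m := 1) (by decide)).differentiableAt one_ne_zero
  have hw {Z : (x : M) → TangentSpace 𝓘(ℝ, E) x} (hZ : MDifferentiableAt 𝓘(ℝ, E)
      𝓘(ℝ, E).tangent (fun z ↦ (⟨z, Z z⟩ : TangentBundle 𝓘(ℝ, E) M)) x)
      (v : TangentSpace 𝓘(ℝ, E) x) :
      mvfderiv 𝓘(ℝ, E) (fun z ↦ mvfderiv 𝓘(ℝ, E) ψ z (Z z)) x v =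
        fderiv ℝ (fun y ↦ fderiv ℝ h y
          (mpullbackWithin 𝓘(ℝ, E) 𝓘(ℝ, E) e.symm Z (range 𝓘(ℝ, E)) y)) (e x)
            (mfderiv 𝓘(ℝ, E) 𝓘(ℝ, E) e x v) := by
    have heq : (fun z ↦ mvfderiv 𝓘(ℝ, E) ψ z (Z z)) =ᶠ[𝓝 x] (fun y ↦ fderiv ℝ h y
          (mpullbackWithin 𝓘(ℝ, E) 𝓘(ℝ, E) e.symm Z (range 𝓘(ℝ, E)) y)) ∘ e := by
      filter_upwards [hd, key Z] with z hz hzZ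
      rw [hz, hzZ]; rfl
    rw [mvfderiv_congr_of_eventuallyEq heq]
    have := mfderiv_comp x (hDh.clm_apply (hdiff hZ)).mdifferentiableAt
      (mdifferentiableAt_extChartAt (I := 𝓘(ℝ, E)) (mem_chart_source E x))
    rw [mfderiv_eq_fderiv] at this
    exact congrArg (fun L : E →L[ℝ] F ↦ L v) this
  rw [hw hX, hw hY, (key X).self_of_nhds, (key Y).self_of_nhds]
  rw [hd.self_of_nhds, mlieBracket, mlieBracketWithin_apply]
  have hinv (w : E) : mfderiv 𝓘(ℝ, E) 𝓘(ℝ, E) e x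
      ((mfderiv 𝓘(ℝ, E) 𝓘(ℝ, E) e x).inverse w) = w :=
    (isInvertible_mfderiv_extChartAt hxs).self_apply_inverse w
  rw [hinv]
  have hb (V W : E → E) (hV : DifferentiableAt ℝ V (e x)) (hW : DifferentiableAt ℝ W (e x)) :
      fderiv ℝ h (e x) (lieBracketWithin ℝ V W univ (e x)) =
        fderiv ℝ (fun y ↦ fderiv ℝ h y (W y)) (e x) (V (e x)) -
          fderiv ℝ (fun y ↦ fderiv ℝ h y (V y)) (e x) (W (e x)) := by
    rw [lieBracketWithin_univ]
    exact fderiv_apply_lieBracket (n := ∞) hhc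
      (by simpa using (by decide : (2 : ℕ∞ω) ≤ ∞)) hW hV
  have hset : (extChartAt 𝓘(ℝ, E) x).symm ⁻¹' univ ∩ range 𝓘(ℝ, E) = univ := by simp
  rw [hset]
  exact hb _ _ (hdiff hX) (hdiff hY)

end Bracket

/-! ### Connections along a map -/

section Along

variable {F : Type*} [NormedAddCommGroup F] [NormedSpace ℝ F]
  {N : Type*} [TopologicalSpace N] [ChartedSpace F N] [IsManifold 𝓘(ℝ, F) ∞ N]

/-- The coordinates of a tangent vector in the trivialization of the tangent bundle at `y₀` are its
image under the derivative of the chart at `y₀`. -/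
lemma trivializationAt_tangent_snd {y₀ y : N} (hy : y ∈ (chartAt F y₀).source)
    (v : TangentSpace 𝓘(ℝ, F) y) :
    (trivializationAt F (fun y : N ↦ TangentSpace 𝓘(ℝ, F) y) y₀ ⟨y, v⟩).2 =
      mvfderiv 𝓘(ℝ, F) (extChartAt 𝓘(ℝ, F) y₀) y v := by
  have h := TangentBundle.continuousLinearMapAt_trivializationAt (I := 𝓘(ℝ, F)) hy
  have h2 := Trivialization.coe_linearMapAt_of_mem (R := ℝ)
    (trivializationAt F (fun y : N ↦ TangentSpace 𝓘(ℝ, F) y) y₀) hy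
  refine (congrFun h2 v).symm.trans ?_
  exact congrArg (fun L : F →L[ℝ] F ↦ L v) h

lemma mdifferentiableAt_trivializationAt_symm (y₀ : N) (a : F) :
    MDifferentiableAt 𝓘(ℝ, F) 𝓘(ℝ, F).tangent (fun y ↦
      (⟨y, (trivializationAt F (fun y : N ↦ TangentSpace 𝓘(ℝ, F) y) y₀).symm y a⟩ :
        TangentBundle 𝓘(ℝ, F) N)) y₀ := by
  refine (mdifferentiableAt_section 𝓘(ℝ, F) _).2 ?_
  refine (mdifferentiableAt_const (c := a)).congr_of_eventuallyEq ?_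
  filter_upwards [chart_source_mem_nhds F y₀] with y hy
  rw [Trivialization.apply_mk_symm _ hy]

variable {E : Type*} [NormedAddCommGroup E] [NormedSpace ℝ E]
  {M : Type*} [TopologicalSpace M] [ChartedSpace E M]

/-- The formula `D̄_U V = ∇_U V + π(V) J U` for sections along `f`: the field to which `covAlong`
applies the connection takes the value `V x` at `f x`. -/
lemma covAlong_quarterSymmetricConnection {g : SemiRiemannianMetric F N} {p q : ℕ}
    (J : MetallicStructure g p q) (η : (y : N) → TangentSpace 𝓘(ℝ, F) y)
    (nab : CovariantDerivative 𝓘(ℝ, F) F (fun y : N ↦ TangentSpace 𝓘(ℝ, F) y))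
    (f : M → N) (V : (x : M) → TangentSpace 𝓘(ℝ, F) (f x)) (x : M) (u : TangentSpace 𝓘(ℝ, E) x) :
    covAlong f (quarterSymmetricConnection J η nab) V x u = covAlong f nab V x u +
      g.inner (f x) (η (f x)) (V x) • J.toFun (f x) (mfderiv 𝓘(ℝ, E) 𝓘(ℝ, F) f x u) := by
  have h : (trivializationAt F (fun y : N ↦ TangentSpace 𝓘(ℝ, F) y) (f x)).symm (f x)
      (trivializationAt F (fun y : N ↦ TangentSpace 𝓘(ℝ, F) y) (f x) ⟨f x, V x⟩).2 = V x :=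
    Trivialization.symm_proj_apply _ (⟨f x, V x⟩ : TangentBundle 𝓘(ℝ, F) N)
      (mem_chart_source F (f x))
  have hD (σ : (y : N) → TangentSpace 𝓘(ℝ, F) y) (y : N) (v : TangentSpace 𝓘(ℝ, F) y) :
      quarterSymmetricConnection J η nab σ y v =
        nab σ y v + g.inner y (η y) (σ y) • J.toFun y v := rfl
  simp only [covAlong, hD, h, add_assoc]

variable [CompleteSpace F]

/-- Vector fields with constant coefficients in a chart `φ` commute: by
`mvfderiv_apply_mlieBracket`, `dφ` sends their bracket to a difference of derivatives of constants.
-/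
lemma mlieBracket_trivializationAt_symm (y₀ : N) (a b : F) :
    VectorField.mlieBracket 𝓘(ℝ, F)
      (fun y ↦ (trivializationAt F (fun y : N ↦ TangentSpace 𝓘(ℝ, F) y) y₀).symm y a)
      (fun y ↦ (trivializationAt F (fun y : N ↦ TangentSpace 𝓘(ℝ, F) y) y₀).symm y b) y₀ = 0 := by
  set φ := extChartAt 𝓘(ℝ, F) y₀ with hφ
  have hev (c : F) : (fun y ↦ mvfderiv 𝓘(ℝ, F) φ y
      ((trivializationAt F (fun y : N ↦ TangentSpace 𝓘(ℝ, F) y) y₀).symm y c)) =ᶠ[𝓝 y₀]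
        fun _ ↦ c := by
    filter_upwards [chart_source_mem_nhds F y₀] with y hy
    rw [hφ, ← trivializationAt_tangent_snd hy, Trivialization.apply_mk_symm _ hy]
  have hinj : Function.Injective (mvfderiv 𝓘(ℝ, F) φ y₀) :=
    (isInvertible_mfderiv_extChartAt (I := 𝓘(ℝ, F)) (mem_extChartAt_source y₀)).injective
  apply hinj
  rw [mvfderiv_apply_mlieBracket contMDiffAt_extChartAt
    (mdifferentiableAt_trivializationAt_symm y₀ a) (mdifferentiableAt_trivializationAt_symm y₀ b)]
  rw [mvfderiv_congr_of_eventuallyEq (hev a), mvfderiv_congr_of_eventuallyEq (hev b),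
    mvfderiv_const, mvfderiv_const, map_zero]
  simp

variable [FiniteDimensional ℝ F] [CompleteSpace E] [IsManifold 𝓘(ℝ, E) ∞ M]

/-- A torsion-free connection on `TN` induces a torsion-free connection along `f : M → N`. In the
coordinates of `covAlong`, the derivatives of the components contribute `df [X, Y]`, and the
remaining terms cancel because coordinate fields commute. -/
lemma covAlong_pushField_sub
    {cov : CovariantDerivative 𝓘(ℝ, F) F (fun y : N ↦ TangentSpace 𝓘(ℝ, F) y)}
    (hcov : cov.torsion = 0) {f : M → N} {x : M} (hf : ContMDiffAt 𝓘(ℝ, E) 𝓘(ℝ, F) ∞ f x)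
    {X Y : (x : M) → TangentSpace 𝓘(ℝ, E) x}
    (hX : MDifferentiableAt 𝓘(ℝ, E) 𝓘(ℝ, E).tangent
      (fun z ↦ (⟨z, X z⟩ : TangentBundle 𝓘(ℝ, E) M)) x)
    (hY : MDifferentiableAt 𝓘(ℝ, E) 𝓘(ℝ, E).tangent
      (fun z ↦ (⟨z, Y z⟩ : TangentBundle 𝓘(ℝ, E) M)) x) :
    covAlong f cov (pushField f Y) x (X x) - covAlong f cov (pushField f X) x (Y x) =
      mfderiv 𝓘(ℝ, E) 𝓘(ℝ, F) f x (VectorField.mlieBracket 𝓘(ℝ, E) X Y x) := by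
  set t := trivializationAt F (fun y : N ↦ TangentSpace 𝓘(ℝ, F) y) (f x) with ht
  set φ := extChartAt 𝓘(ℝ, F) (f x)
  have hft : f x ∈ t.baseSet := mem_chart_source F (f x)
  have hsymm (v : TangentSpace 𝓘(ℝ, F) (f x)) : t.symm (f x) (t ⟨f x, v⟩).2 = v :=
    t.symm_proj_apply ⟨f x, v⟩ hft
  have hφf : ContMDiffAt 𝓘(ℝ, E) 𝓘(ℝ, F) ∞ (φ ∘ f) x := contMDiffAt_extChartAt.comp x hf
  have hcoord : ∀ᶠ z in 𝓝 x, ∀ v : TangentSpace 𝓘(ℝ, E) z,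
      (t ⟨f z, mfderiv 𝓘(ℝ, E) 𝓘(ℝ, F) f z v⟩).2 = mvfderiv 𝓘(ℝ, E) (φ ∘ f) z v := by
    have hf1 : ContMDiffAt 𝓘(ℝ, E) 𝓘(ℝ, F) 1 f x := hf.of_le (by simp)
    filter_upwards [hf.continuousAt.eventually (chart_source_mem_nhds F (f x)),
      (contMDiffAt_iff_contMDiffAt_nhds (by simp)).1 hf1] with z hz hfz v
    have h := mfderiv_comp z (mdifferentiableAt_extChartAt (I := 𝓘(ℝ, F)) hz)
      (hfz.mdifferentiableAt one_ne_zero)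
    rw [ht, trivializationAt_tangent_snd hz]
    exact (congrArg (fun L : E →L[ℝ] F ↦ L v) h).symm
  have hw (Z : (x : M) → TangentSpace 𝓘(ℝ, E) x) (u : TangentSpace 𝓘(ℝ, E) x) :
      mfderiv 𝓘(ℝ, E) 𝓘(ℝ, F) (fun z ↦ (t ⟨f z, pushField f Z z⟩).2) x u =
        mvfderiv 𝓘(ℝ, E) (fun z ↦ mvfderiv 𝓘(ℝ, E) (φ ∘ f) z (Z z)) x u := by
    have h : (fun z ↦ (t ⟨f z, pushField f Z z⟩).2) =ᶠ[𝓝 x]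
        fun z ↦ mvfderiv 𝓘(ℝ, E) (φ ∘ f) z (Z z) := by
      filter_upwards [hcoord] with z hz using hz (Z z)
    exact congrArg (fun L : E →L[ℝ] F ↦ L u) (h.mfderiv_eq (I := 𝓘(ℝ, E)) (I' := 𝓘(ℝ, F)))
  have htor (v w : TangentSpace 𝓘(ℝ, F) (f x)) :
      cov (fun y ↦ t.symm y (t ⟨f x, w⟩).2) (f x) v -
        cov (fun y ↦ t.symm y (t ⟨f x, v⟩).2) (f x) w = 0 := by
    have h := (CovariantDerivative.torsion_eq_zero_iff cov).1 hcov
      (mdifferentiableAt_trivializationAt_symm (f x) (t ⟨f x, v⟩).2)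
      (mdifferentiableAt_trivializationAt_symm (f x) (t ⟨f x, w⟩).2)
    rwa [hsymm, hsymm, mlieBracket_trivializationAt_symm] at h
  simp only [covAlong, ← ht]
  rw [hw, hw, add_sub_add_comm]
  simp only [pushField]
  rw [htor, add_zero]
  -- `Trivialization.symm` is a bare function, linear over the base set
  have hlin (a b : F) : t.symm (f x) a - t.symm (f x) b = t.symm (f x) (a - b) := by
    simp only [← t.symmL_apply (R := ℝ) hft, map_sub]
  rw [hlin, ← mvfderiv_apply_mlieBracket hφf hX hY, ← hcoord.self_of_nhds, hsymm]

end Along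

/-! ### The radical distribution of a screen semi-invariant lightlike submanifold -/

namespace LightlikeSubmanifold

set_option linter.unusedSectionVars false

variable {F : Type*} [NormedAddCommGroup F] [NormedSpace ℝ F] [FiniteDimensional ℝ F]
  {N : Type*} [TopologicalSpace N] [ChartedSpace F N] [IsManifold 𝓘(ℝ, F) ∞ N]
  {E : Type*} [NormedAddCommGroup E] [NormedSpace ℝ E] [FiniteDimensional ℝ E]
  {M : Type*} [TopologicalSpace M] [ChartedSpace E M] [IsManifold 𝓘(ℝ, E) ∞ M]
  {g : SemiRiemannianMetric F N} (S : LightlikeSubmanifold E M g)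

lemma projScreen_of_mem_screen {x : M} {v : TangentSpace 𝓘(ℝ, F) (S.f x)}
    (hv : v ∈ S.screen x) : S.projScreen x v = v :=
  Submodule.projection_apply_of_mem_left (S.isCompl_screen x) hv

lemma projScreen_of_mem_rad {x : M} {v : TangentSpace 𝓘(ℝ, F) (S.f x)}
    (hv : v ∈ S.rad x) : S.projScreen x v = 0 :=
  (Submodule.projection_apply_eq_zero_iff _).2 (Submodule.mem_sup_left hv)

lemma projScreen_of_mem_screenTr {x : M} {v : TangentSpace 𝓘(ℝ, F) (S.f x)}
    (hv : v ∈ S.screenTr x) : S.projScreen x v = 0 :=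
  (Submodule.projection_apply_eq_zero_iff _).2
    (Submodule.mem_sup_right (Submodule.mem_sup_right hv))

lemma projScreenTr_of_mem_screenTr {x : M} {v : TangentSpace 𝓘(ℝ, F) (S.f x)}
    (hv : v ∈ S.screenTr x) : S.projScreenTr x v = v :=
  Submodule.projection_apply_of_mem_left (S.isCompl_screenTr x) hv

lemma projScreenTr_of_mem_tan {x : M} {v : TangentSpace 𝓘(ℝ, F) (S.f x)}
    (hv : v ∈ S.tan x) : S.projScreenTr x v = 0 :=
  (Submodule.projection_apply_eq_zero_iff _).2 (Submodule.mem_sup_right hv)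

lemma rad_le_tan (x : M) : S.rad x ≤ S.tan x := inf_le_left

lemma screen_le_tan (x : M) : S.screen x ≤ S.tan x :=
  le_sup_right.trans (S.radical_sup_screen x).le

lemma projScreen_projTan (x : M) (v : TangentSpace 𝓘(ℝ, F) (S.f x)) :
    S.projScreen x (S.projTan x v) = S.projScreen x v := by
  have h : v - S.projTan x v ∈ S.ltr x ⊔ S.screenTr x :=
    Submodule.sub_projection_mem (S.isCompl_tr x) v
  have h0 : S.projScreen x (v - S.projTan x v) = 0 :=
    (Submodule.projection_apply_eq_zero_iff _).2 (Submodule.mem_sup_right h)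
  rw [map_sub, sub_eq_zero] at h0
  exact h0.symm

variable {p q : ℕ} {J : MetallicStructure g p q}

lemma IsScreenSemiInvariant.apply_mem_rad {S : LightlikeSubmanifold E M g}
    (hS : S.IsScreenSemiInvariant J) {x : M}
    {v : TangentSpace 𝓘(ℝ, F) (S.f x)} (hv : v ∈ S.rad x) : J.toFun (S.f x) v ∈ S.rad x :=
  (hS.2 x).le (Submodule.mem_map_of_mem hv)

/-- Write `W = ξ + b + b'` along `TM = Rad(TM) ⊕ B ⊕ B^⊥`. The parts of `J W` in `S(TM)` and
`S(TM^⊥)` are `J b` and `J b'`. If `J b' = 0`, then `q b' = 0`; if moreover `J b = p b`, then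
`q b = 0`. Both follow from `J² = p J + q I`. -/
lemma IsScreenSemiInvariant.mem_rad_iff {S : LightlikeSubmanifold E M g}
    (hS : S.IsScreenSemiInvariant J) (hq : 0 < q) {x : M}
    {W : TangentSpace 𝓘(ℝ, F) (S.f x)} (hW : W ∈ S.tan x) :
    W ∈ S.rad x ↔ S.projScreen x (J.toFun (S.f x) W) = (p : ℝ) • S.projScreen x W ∧
      S.projScreenTr x (J.toFun (S.f x) W) = 0 := by
  have hq' : (q : ℝ) ≠ 0 := by exact_mod_cast hq.ne'
  constructor
  · intro h
    have hJ := hS.apply_mem_rad h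
    rw [S.projScreen_of_mem_rad h, S.projScreen_of_mem_rad hJ,
      S.projScreenTr_of_mem_tan (S.rad_le_tan x hJ)]
    simp
  · obtain ⟨B, -, hB⟩ := hS.1
    obtain ⟨hBS, -, hBsup, hJB, hJB'⟩ := hB x
    rw [tan, ← S.radical_sup_screen x, ← hBsup] at hW
    obtain ⟨ξ, hξ, s, hs, rfl⟩ := Submodule.mem_sup.1 hW
    obtain ⟨b, hb, b', hb', rfl⟩ := Submodule.mem_sup.1 hs
    have hJξ := hS.apply_mem_rad hξ
    have hJb : J.toFun (S.f x) b ∈ S.screen x := hBS (hJB.le (Submodule.mem_map_of_mem hb))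
    have hJb' : J.toFun (S.f x) b' ∈ S.screenTr x := hJB' (Submodule.mem_map_of_mem hb')
    simp only [map_add, S.projScreen_of_mem_rad hJξ, S.projScreen_of_mem_rad hξ,
      S.projScreen_of_mem_screen hJb, S.projScreen_of_mem_screen (hBS hb),
      S.projScreen_of_mem_screen hb'.2, S.projScreen_of_mem_screenTr hJb',
      S.projScreenTr_of_mem_tan (S.rad_le_tan x hJξ), S.projScreenTr_of_mem_screenTr hJb',
      S.projScreenTr_of_mem_tan (S.screen_le_tan x hJb), zero_add, add_zero]
    rintro ⟨h1, h2⟩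
    have hb0' : b' = 0 := by
      have h := J.sq_eq (S.f x) b'
      rw [h2, map_zero, smul_zero, zero_add] at h
      exact (smul_eq_zero.1 h.symm).resolve_left hq'
    rw [hb0', add_zero] at h1
    have hb0 : b = 0 := by
      have h := J.sq_eq (S.f x) b
      rw [h1, map_smul, h1, left_eq_add] at h
      exact (smul_eq_zero.1 h).resolve_left hq'
    simpa [hb0, hb0'] using hξ

section QuarterSymmetric

variable (J) (η : (y : N) → TangentSpace 𝓘(ℝ, F) y)
  (nab : CovariantDerivative 𝓘(ℝ, F) F (fun y : N ↦ TangentSpace 𝓘(ℝ, F) y))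

/-- Along radical directions the term `π(V) J U` of the quarter symmetric connection is radical, so
that it does not contribute to the shape operator. -/
lemma IsScreenSemiInvariant.radicalShapeOperator_eq {S : LightlikeSubmanifold E M g}
    (hS : S.IsScreenSemiInvariant J) (V : (x : M) → TangentSpace 𝓘(ℝ, F) (S.f x)) {x : M}
    {u : TangentSpace 𝓘(ℝ, E) x} (hu : mfderiv 𝓘(ℝ, E) 𝓘(ℝ, F) S.f x u ∈ S.rad x) :
    S.radicalShapeOperator (quarterSymmetricConnection J η nab) V x u =
      -S.projScreen x (covAlong S.f nab V x u) := by
  rw [radicalShapeOperator, inducedConnection, projScreen_projTan,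
    covAlong_quarterSymmetricConnection, map_add, map_smul,
    S.projScreen_of_mem_rad (hS.apply_mem_rad hu), smul_zero, add_zero]

lemma IsScreenSemiInvariant.screenSecondFundamentalForm_eq {S : LightlikeSubmanifold E M g}
    (hS : S.IsScreenSemiInvariant J) (V : (x : M) → TangentSpace 𝓘(ℝ, F) (S.f x)) {x : M}
    {u : TangentSpace 𝓘(ℝ, E) x} (hu : mfderiv 𝓘(ℝ, E) 𝓘(ℝ, F) S.f x u ∈ S.rad x) :
    S.screenSecondFundamentalForm (quarterSymmetricConnection J η nab) x u V =
      S.projScreenTr x (covAlong S.f nab V x u) := by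
  rw [screenSecondFundamentalForm,
    covAlong_quarterSymmetricConnection, map_add, map_smul,
    S.projScreenTr_of_mem_tan (S.rad_le_tan x (hS.apply_mem_rad hu)), smul_zero, add_zero]

end QuarterSymmetric

lemma IsSmoothField.mlieBracket {X Y : (x : M) → TangentSpace 𝓘(ℝ, E) x}
    (hX : IsSmoothField X) (hY : IsSmoothField Y) :
    IsSmoothField (VectorField.mlieBracket 𝓘(ℝ, E) X Y) := by
  have : IsManifold 𝓘(ℝ, E) (minSmoothness ℝ 2) M := by
    rw [minSmoothness_of_isRCLikeNormedField]
    infer_instance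
  have : IsManifold 𝓘(ℝ, E) (((⊤ : ℕ∞) : ℕ∞ω) + 1) M := by simpa
  exact ContDiff.mlieBracket_vectorField (m := ⊤) (n := ⊤) hX hY (by simp)

lemma radicalIntegrable_iff : S.RadicalIntegrable ↔
    ∀ X Y : (x : M) → TangentSpace 𝓘(ℝ, E) x, S.IsRadicalField X → S.IsRadicalField Y →
      ∀ x, pushField S.f (VectorField.mlieBracket 𝓘(ℝ, E) X Y) x ∈ S.rad x :=
  forall₄_congr fun _ _ hX hY ↦ and_iff_right (IsSmoothField.mlieBracket hX.1 hY.1)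

/-- The two conditions of the integrability criterion, for a pair of radical fields and at a point,
say that `W = [X, Y]` satisfies the criterion of `IsScreenSemiInvariant.mem_rad_iff`, because
`∇_X (J Y) - ∇_Y (J X) = J (∇_X Y - ∇_Y X) = J W`. -/
lemma IsScreenSemiInvariant.mlieBracket_mem_rad_iff {S : LightlikeSubmanifold E M g}
    (hS : S.IsScreenSemiInvariant J) (hq : 0 < q)
    {nab : CovariantDerivative 𝓘(ℝ, F) F (fun y : N ↦ TangentSpace 𝓘(ℝ, F) y)}
    (hnab : nab.torsion = 0) (hJ : S.IsParallelOnTangent nab J)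
    (η : (y : N) → TangentSpace 𝓘(ℝ, F) y) {X Y : (x : M) → TangentSpace 𝓘(ℝ, E) x}
    (hX : S.IsRadicalField X) (hY : S.IsRadicalField Y) (x : M) :
    pushField S.f (VectorField.mlieBracket 𝓘(ℝ, E) X Y) x ∈ S.rad x ↔
      (S.radicalShapeOperator (quarterSymmetricConnection J η nab) (S.applyJ J X) x (Y x) +
          (p : ℝ) • S.radicalShapeOperator (quarterSymmetricConnection J η nab)
            (pushField S.f Y) x (X x) =
        S.radicalShapeOperator (quarterSymmetricConnection J η nab) (S.applyJ J Y) x (X x) +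
          (p : ℝ) • S.radicalShapeOperator (quarterSymmetricConnection J η nab)
            (pushField S.f X) x (Y x)) ∧
      S.screenSecondFundamentalForm (quarterSymmetricConnection J η nab) x (X x) (S.applyJ J Y) =
        S.screenSecondFundamentalForm (quarterSymmetricConnection J η nab) x (Y x)
          (S.applyJ J X) := by
  have hb : covAlong S.f nab (pushField S.f Y) x (X x) -
      covAlong S.f nab (pushField S.f X) x (Y x) =
        pushField S.f (VectorField.mlieBracket 𝓘(ℝ, E) X Y) x :=
    covAlong_pushField_sub hnab (S.immersion.contMDiff x)
      ((hX.1 x).mdifferentiableAt (by simp)) ((hY.1 x).mdifferentiableAt (by simp))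
  have hW : pushField S.f (VectorField.mlieBracket 𝓘(ℝ, E) X Y) x ∈ S.tan x :=
    LinearMap.mem_range_self _ _
  rw [hS.mem_rad_iff hq hW, ← hb,
    hS.radicalShapeOperator_eq J η nab _ (hY.2 x), hS.radicalShapeOperator_eq J η nab _ (hY.2 x),
    hS.radicalShapeOperator_eq J η nab _ (hX.2 x), hS.radicalShapeOperator_eq J η nab _ (hX.2 x),
    hS.screenSecondFundamentalForm_eq J η nab _ (hX.2 x),
    hS.screenSecondFundamentalForm_eq J η nab _ (hY.2 x),
    hJ X hX.1, hJ Y hY.1]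
  simp only [map_sub, smul_sub, smul_neg, sub_eq_zero]
  refine and_congr_left fun _ ↦ ?_
  rw [← sub_eq_zero, ← sub_eq_zero (a := -_ + _)]
  exact Eq.congr_left (by abel)

end LightlikeSubmanifold

end LightlikeGeometry

theorem mainTheorem5
    {F : Type*} [NormedAddCommGroup F] [NormedSpace ℝ F] [FiniteDimensional ℝ F]
    {N : Type*} [TopologicalSpace N] [T2Space N] [SecondCountableTopology N]
    [ChartedSpace F N] [IsManifold 𝓘(ℝ, F) ∞ N]
    {E : Type*} [NormedAddCommGroup E] [NormedSpace ℝ E] [FiniteDimensional ℝ E]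
    {M : Type*} [TopologicalSpace M] [T2Space M] [SecondCountableTopology M]
    [ChartedSpace E M] [IsManifold 𝓘(ℝ, E) ∞ M]
    (g : LightlikeGeometry.SemiRiemannianMetric F N)
    (nab : CovariantDerivative 𝓘(ℝ, F) F (fun y : N ↦ TangentSpace 𝓘(ℝ, F) y))
    (hnab : LightlikeGeometry.IsLeviCivita g nab)
    (p q : ℕ) (hp : 0 < p) (hq : 0 < q)
    (J : LightlikeGeometry.MetallicStructure g p q)
    (η : (y : N) → TangentSpace 𝓘(ℝ, F) y)
    (hη : ContMDiff 𝓘(ℝ, F) 𝓘(ℝ, F).tangent ∞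
      (fun y ↦ (⟨y, η y⟩ : TangentBundle 𝓘(ℝ, F) N)))
    (S : LightlikeGeometry.LightlikeSubmanifold E M g)
    (hS : S.IsScreenSemiInvariant J)
    (hJ : S.IsParallelOnTangent nab J)
    (D : CovariantDerivative 𝓘(ℝ, F) F (fun y : N ↦ TangentSpace 𝓘(ℝ, F) y))
    (hD : D = LightlikeGeometry.quarterSymmetricConnection J η nab) :
    S.RadicalIntegrable ↔
      (∀ X Y : (x : M) → TangentSpace 𝓘(ℝ, E) x, S.IsRadicalField X → S.IsRadicalField Y →
        ∀ x : M,
          S.radicalShapeOperator D (S.applyJ J X) x (Y x) +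
              (p : ℝ) • S.radicalShapeOperator D
                (LightlikeGeometry.pushField S.f Y) x (X x) =
            S.radicalShapeOperator D (S.applyJ J Y) x (X x) +
              (p : ℝ) • S.radicalShapeOperator D
                (LightlikeGeometry.pushField S.f X) x (Y x)) ∧
      (∀ X Y : (x : M) → TangentSpace 𝓘(ℝ, E) x, S.IsRadicalField X → S.IsRadicalField Y →
        ∀ x : M,
          S.screenSecondFundamentalForm D x (X x) (S.applyJ J Y) =
            S.screenSecondFundamentalForm D x (Y x) (S.applyJ J X)) := by
  subst hD
  have key {X Y : (x : M) → TangentSpace 𝓘(ℝ, E) x} (hX : S.IsRadicalField X)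
      (hY : S.IsRadicalField Y) (x : M) :=
    hS.mlieBracket_mem_rad_iff hq hnab.torsion_free hJ η hX hY x
  rw [S.radicalIntegrable_iff]
  exact ⟨fun h ↦ ⟨fun X Y hX hY x ↦ ((key hX hY x).1 (h X Y hX hY x)).1,
    fun X Y hX hY x ↦ ((key hX hY x).1 (h X Y hX hY x)).2⟩,
    fun h X Y hX hY x ↦ (key hX hY x).2 ⟨h.1 X Y hX hY x, h.2 X Y hX hY x⟩⟩
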